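/- Let $P,Q$ be positive definite complex $d\times d$ matrices. For a positive definite matrix $R$ let $$F_R(P,Q)=\operatorname{Tr}\!\left[(R^{1/2}PR^{1/2})^{1/2}R^{-1}(R^{1/2}QR^{1/2})^{1/2}\right],$$ and for $x\in\mathbb R$ put $\Phi_P(x)=F_{P^x}(P,Q)$, $\Phi_Q(x)=F_{Q^x}(P,Q)$, and let $$F_x^{\mathrm{pol}}(P,Q)=\tfrac12\bigl(\Phi_P(x)+\Phi_Q(x)\bigr)$$ be the symmetrized polar fidelity. Let $$F^{\mathrm U}(P,Q)=\operatorname{Tr}\!\left[(P^{1/2}QP^{1/2})^{1/2}\right],\qquad F^{\mathrm H}(P,Q)=\operatorname{Tr}(P^{1/2}Q^{1/2}),\qquad F^{\mathrm M}(P,Q)=\operatorname{Tr}\!\left[P^{1/2}(P^{-1/2}QP^{-1/2})^{1/2}P^{1/2}\right]$$ be the Uhlmann, Holevo and Matsumoto fidelities. Then all of $\Phi_P(x),\Phi_Q(x),F_x^{\mathrm{pol}}(P,Q)$ ($x\in\mathbb R$) and $F^{\mathrm U}(P,Q),F^{\mathrm H}(P,Q),F^{\mathrm M}(P,Q)$ are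 real numbers, and the following hold. 1. The map $x\mapsto F_x^{\mathrm{pol}}(P,Q)$ is nondecreasing on $(-\infty,1]$ and nonincreasing on $[1,\infty)$. It attains a global maximum at $x=1$, where $\Phi_P(1)=\Phi_Q(1)=F_1^{\mathrm{pol}}(P,Q)=F^{\mathrm U}(P,Q)$; thus $F_x^{\mathrm{pol}}(P,Q)\le F^{\mathrm U}(P,Q)$ for all $x\in\mathbb R$. 2. In particular $x\mapsto F_x^{\mathrm{pol}}(P,Q)$ is nondecreasing on $[-1,1]$, with $F_{-1}^{\mathrm{pol}}(P,Q)=F^{\mathrm M}(P,Q)$, $F_{0}^{\mathrm{pol}}(P,Q)=F^{\mathrm H}(P,Q)$ and $F_{1}^{\mathrm{pol}}(P,Q)=F^{\mathrm U}(P,Q)$; hence $F^{\mathrm M}(P,Q)\le F_x^{\mathrm{pol}}(P,Q)\le F^{\mathrm U}(P,Q)$ for $x\in[-1,1]$. 3. If $PQ=QP$, then $\Phi_P(x)=\Phi_Q(x)=F_x^{\mathrm{pol}}(P,Q)=\operatorname{Tr}(P^{1/2}Q^{1/2})$ for every $x\in\mathbb R$; hence every $x\in\mathbb R$ is then a global maximizer,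 so the maximizer $x=1$ need not be unique. -/

import Mathlib

open scoped MatrixOrder ComplexOrder

noncomputable section

/-- The generalized fidelity
`F_R(P,Q) = Tr[(R^{1/2} P R^{1/2})^{1/2} R⁻¹ (R^{1/2} Q R^{1/2})^{1/2}]`, a complex number.
Real powers of matrices are taken by the functional calculus. -/
def genFidelity {d : ℕ} (R P Q : Matrix (Fin d) (Fin d) ℂ) : ℂ :=
  (CFC.rpow (CFC.rpow R (1 / 2) * P * CFC.rpow R (1 / 2)) (1 / 2) * R⁻¹ *
    CFC.rpow (CFC.rpow R (1 / 2) * Q * CFC.rpow R (1 / 2)) (1 / 2)).trace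

/-- The one-sided polar fidelity `Φ_P(x) = F_{P^x}(P,Q)`. -/
def polarLeft {d : ℕ} (P Q : Matrix (Fin d) (Fin d) ℂ) (x : ℝ) : ℂ :=
  genFidelity (CFC.rpow P x) P Q

/-- The one-sided polar fidelity `Φ_Q(x) = F_{Q^x}(P,Q)`. -/
def polarRight {d : ℕ} (P Q : Matrix (Fin d) (Fin d) ℂ) (x : ℝ) : ℂ :=
  genFidelity (CFC.rpow Q x) P Q

/-- The symmetrized `x`-polar fidelity `(F_{P^x}(P,Q) + F_{Q^x}(P,Q)) / 2`. -/
def polarFidelity {d : ℕ} (P Q : Matrix (Fin d) (Fin d) ℂ) (x : ℝ) : ℂ :=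
  (polarLeft P Q x + polarRight P Q x) / 2

/-- Uhlmann fidelity `Tr[(P^{1/2} Q P^{1/2})^{1/2}]`. -/
def uhlmannFidelity {d : ℕ} (P Q : Matrix (Fin d) (Fin d) ℂ) : ℂ :=
  (CFC.rpow (CFC.rpow P (1 / 2) * Q * CFC.rpow P (1 / 2)) (1 / 2)).trace

/-- Holevo fidelity `Tr[P^{1/2} Q^{1/2}]`. -/
def holevoFidelity {d : ℕ} (P Q : Matrix (Fin d) (Fin d) ℂ) : ℂ :=
  (CFC.rpow P (1 / 2) * CFC.rpow Q (1 / 2)).trace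

/-- Matsumoto fidelity: the trace of the geometric mean
`P^{1/2} (P^{-1/2} Q P^{-1/2})^{1/2} P^{1/2}`. -/
def matsumotoFidelity {d : ℕ} (P Q : Matrix (Fin d) (Fin d) ℂ) : ℂ :=
  (CFC.rpow P (1 / 2) *
    CFC.rpow (CFC.rpow P (-1 / 2) * Q * CFC.rpow P (-1 / 2)) (1 / 2) *
    CFC.rpow P (1 / 2)).trace

end

/-! Since `P` commutes with its powers, `Φ_P(x) = Tr[W A]` with `W = P^{(1-x)/2}` and `A = (P^{x/2}
Q P^{x/2})^{1/2}` (`polarLeft_eq`). Put `H = ½ log P`; then `(A²)' = H A² + A² H` and `W' = -H W`.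
If `X` solves `A X + X A = W`, self-adjointness of the Lyapunov operator gives `Tr[W A'] = Tr[(A²)'
X]`, so `Φ_P' = Tr[(H A² + A² H) X] - Tr[H W A]` (`hasDerivAt_trace_mul_of_sq`). In the spectral
projections `E_k` of `P` this equals `∑ m_kl (h_k - h_l)(w_k - w_l)` with weights `m_kl ≥ 0`
(`exists_lyapunov_trace_eq_sum`), where `h_k = ½ log p_k` and `w_k = p_k^{(1-x)/2}`. The two
families are similarly ordered for `x ≤ 1` and oppositely ordered for `x ≥ 1`, which fixes the sign
of the derivative. Thus each one-sided fidelity is already monotone on either side of `1`. Symmetry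
of the three classical fidelities in `P, Q` then identifies the averaged values at `-1, 0, 1`. -/

namespace Matrix

open scoped Matrix.Norms.Frobenius

variable {n : Type*} [Fintype n] [DecidableEq n]

/-! ### The Lyapunov equation. -/

/-- The squared Frobenius norm is a trace. -/
lemma frobenius_norm_sq_eq_re_trace (A : Matrix n n ℂ) :
    ‖A‖ ^ 2 = (Aᴴ * A).trace.re := by
  rw [frobenius_norm_def, ← Real.rpow_natCast, ← Real.rpow_mul (by positivity)]
  simp only [trace, diag_apply, mul_apply, conjTranspose_apply, Complex.re_sum]
  rw [Finset.sum_comm]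
  norm_num
  refine Finset.sum_congr rfl fun i _ => Finset.sum_congr rfl fun j _ => ?_
  rw [← Complex.normSq_eq_norm_sq, Complex.normSq_apply]

lemma PosSemidef.trace_mul_nonneg {A B : Matrix n n ℂ} (hA : A.PosSemidef) (hB : B.PosSemidef) :
    0 ≤ (A * B).trace := by
  have h := (hB.mul_mul_conjTranspose_same (CFC.sqrt A)).trace_nonneg
  have hs : (CFC.sqrt A)ᴴ = CFC.sqrt A := (CFC.sqrt_nonneg A).isSelfAdjoint
  rw [hs, trace_mul_comm, ← Matrix.mul_assoc, CFC.sqrt_mul_sqrt_self A hA.nonneg] at h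
  exact h

/-- A coercivity estimate for the Sylvester operator `Y ↦ B Y + Y A`. -/
lemma mul_norm_le_norm_sylvester {A B : Matrix n n ℂ} {c : ℝ} (hc : 0 < c)
    (hA : (A - (c : ℂ) • (1 : Matrix n n ℂ)).PosSemidef) (hB : B.PosSemidef) (Y : Matrix n n ℂ) :
    c * ‖Y‖ ≤ ‖B * Y + Y * A‖ := by
  set C := B * Y + Y * A with hC
  have h1 : 0 ≤ (Yᴴ * B * Y).trace.re :=
    (Complex.le_def.1 (hB.conjTranspose_mul_mul_same Y).trace_nonneg).1
  have h2 : 0 ≤ (Y * (A - (c : ℂ) • (1 : Matrix n n ℂ)) * Yᴴ).trace.re :=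
    (Complex.le_def.1 (hA.mul_mul_conjTranspose_same Y).trace_nonneg).1
  have h3 : (Y * (A - (c : ℂ) • (1 : Matrix n n ℂ)) * Yᴴ).trace.re =
      (Yᴴ * (Y * A)).trace.re - c * ‖Y‖ ^ 2 := by
    rw [trace_mul_comm, frobenius_norm_sq_eq_re_trace, Matrix.mul_sub, Matrix.mul_sub]
    simp
  have h4 : (Yᴴ * C).trace.re = (Yᴴ * B * Y).trace.re + (Yᴴ * (Y * A)).trace.re := by
    rw [hC, Matrix.mul_add, trace_add, Complex.add_re, Matrix.mul_assoc Yᴴ B Y]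
  have h5 : (Cᴴ * Y).trace.re = (Yᴴ * C).trace.re := by
    have : (Cᴴ * Y) = (Yᴴ * C)ᴴ := by simp
    rw [this, trace_conjTranspose]; simp
  -- Nonnegativity of this square, together with `c‖Y‖² ≤ Re Tr(Yᴴ C)`, replaces Cauchy-Schwarz.
  have h6 : ‖(c : ℂ) • Y - C‖ ^ 2 = c ^ 2 * ‖Y‖ ^ 2 - 2 * c * (Yᴴ * C).trace.re + ‖C‖ ^ 2 := by
    simp only [frobenius_norm_sq_eq_re_trace, conjTranspose_sub, conjTranspose_smul,
      Matrix.sub_mul, Matrix.mul_sub, trace_sub, Matrix.smul_mul, Matrix.mul_smul, trace_smul,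
      Complex.sub_re, smul_eq_mul, Complex.star_def, Complex.conj_ofReal, Complex.re_ofReal_mul, h5]
    ring
  have h7 : c * ‖Y‖ ^ 2 ≤ (Yᴴ * C).trace.re := by linarith
  refine le_of_sq_le_sq ?_ (norm_nonneg _)
  nlinarith [sq_nonneg ‖(c : ℂ) • Y - C‖, mul_le_mul_of_nonneg_left h7 hc.le]

lemma PosDef.exists_pos_sub_posSemidef {A : Matrix n n ℂ} (hA : A.PosDef) :
    ∃ c : ℝ, 0 < c ∧ (A - (c : ℂ) • (1 : Matrix n n ℂ)).PosSemidef := by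
  rcases subsingleton_or_nontrivial (Matrix n n ℂ) with hs | hs
  · exact ⟨1, one_pos, by rw [Subsingleton.elim (A - _) 0]; exact PosSemidef.zero⟩
  obtain ⟨c, hc, h⟩ := (CFC.exists_pos_algebraMap_le_iff (A := Matrix n n ℂ) hA.1).2 fun x hx => by
    rw [hA.1.spectrum_real_eq_range_eigenvalues] at hx
    obtain ⟨i, rfl⟩ := hx
    exact hA.eigenvalues_pos i
  refine ⟨c, hc, ?_⟩
  have e : (c : ℂ) • (1 : Matrix n n ℂ) = algebraMap ℝ (Matrix n n ℂ) c := by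
    ext i j
    simp [algebraMap_matrix_apply, Matrix.one_apply]
  rw [e]
  exact le_iff.1 h

lemma PosDef.lyapunov_injective {A X Y : Matrix n n ℂ} (hA : A.PosDef)
    (h : A * X + X * A = A * Y + Y * A) : X = Y := by
  obtain ⟨c, hc, hcA⟩ := hA.exists_pos_sub_posSemidef
  have h1 := mul_norm_le_norm_sylvester hc hcA hA.posSemidef (X - Y)
  have h2 : A * (X - Y) + (X - Y) * A = 0 := by
    rw [Matrix.mul_sub, Matrix.sub_mul, sub_add_sub_comm, h, sub_self]
  rw [h2, norm_zero] at h1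
  have h3 : ‖X - Y‖ ≤ 0 := by
    by_contra! h3
    nlinarith [mul_pos hc h3]
  exact sub_eq_zero.1 (norm_le_zero_iff.1 h3)

/-- The Lyapunov equation `A X + X A = W` is solvable for positive definite `A`. -/
lemma PosDef.exists_lyapunov {A : Matrix n n ℂ} (hA : A.PosDef) (W : Matrix n n ℂ) :
    ∃ X, A * X + X * A = W := by
  let L : Matrix n n ℂ →ₗ[ℂ] Matrix n n ℂ := LinearMap.mulLeft ℂ A + LinearMap.mulRight ℂ A
  have hL : Function.Injective L := fun X Y h => hA.lyapunov_injective h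
  exact (LinearMap.injective_iff_surjective.1 hL) W

/-- Lyapunov's theorem: the solution for a positive semidefinite right side is such. -/
lemma PosDef.lyapunov_posSemidef {A X W : Matrix n n ℂ} (hA : A.PosDef) (hW : W.PosSemidef)
    (h : A * X + X * A = W) : X.PosSemidef := by
  -- `Xᴴ` solves the same equation, so uniqueness gives `Xᴴ = X`.
  have hX : X.IsHermitian := by
    refine hA.lyapunov_injective ?_
    have h' : (A * X + X * A)ᴴ = Wᴴ := by rw [h]
    rw [conjTranspose_add, conjTranspose_mul, conjTranspose_mul, hA.1.eq, hW.1.eq] at h'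
    rw [h, ← h', add_comm]
  rw [hX.posSemidef_iff_eigenvalues_nonneg]
  intro i
  set U : Matrix n n ℂ := (hX.eigenvectorUnitary : Matrix n n ℂ) with hU
  set D : Matrix n n ℂ := diagonal (fun j => (hX.eigenvalues j : ℂ)) with hD
  have hUU : Uᴴ * U = 1 := by
    rw [← star_eq_conjTranspose]; exact Unitary.coe_star_mul_self _
  have hUU' : U * Uᴴ = 1 := mul_eq_one_comm.1 hUU
  have hXd : X = U * D * Uᴴ := hX.spectral_theorem
  have hA' : (Uᴴ * A * U).PosDef := by
    refine hA.conjTranspose_mul_mul_same ?_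
    intro v w hvw
    have := congrArg (Uᴴ *ᵥ ·) hvw
    simpa [hUU] using this
  have key : Uᴴ * W * U = (Uᴴ * A * U) * D + D * (Uᴴ * A * U) := by
    have e1 : X * U = U * D := by rw [hXd, Matrix.mul_assoc _ Uᴴ, hUU, Matrix.mul_one]
    have e2 : Uᴴ * X = D * Uᴴ := by
      rw [hXd, ← Matrix.mul_assoc, ← Matrix.mul_assoc, hUU, Matrix.one_mul]
    rw [← h, Matrix.mul_add, Matrix.add_mul]
    simp only [Matrix.mul_assoc]
    rw [e1]
    congr 1
    rw [← Matrix.mul_assoc, e2]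
    simp only [Matrix.mul_assoc]
  -- In an eigenbasis of `X`, the `i`-th diagonal entry of `W` is `2 a_ii λ_i` with `a_ii > 0`, so
  -- `λ_i ≥ 0`.
  have h1 := (hW.conjTranspose_mul_mul_same U).diag_nonneg (i := i)
  have h2 := hA'.diag_pos (i := i)
  rw [key, add_apply, hD, mul_diagonal, diagonal_mul] at h1
  have h3 := (Complex.le_def.1 h1).1
  have h4 := (Complex.lt_def.1 h2).1
  simp only [Complex.zero_re, Complex.add_re, Complex.re_ofReal_mul, Complex.re_mul_ofReal] at h3 h4
  simp only [Pi.zero_apply]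
  by_contra! h5
  nlinarith [mul_neg_of_neg_of_pos h5 h4]

/-! ### Spectral resolutions and the double sum. -/

/-- A finite resolution of the identity by positive semidefinite orthogonal idempotents. -/
structure IsSpectralResolution (E : n → Matrix n n ℂ) : Prop where
  posSemidef : ∀ k, (E k).PosSemidef
  mul_eq : ∀ k l, E k * E l = if k = l then E k else 0
  sum_eq : ∑ k, E k = 1

lemma IsSpectralResolution.sum_smul_mul_sum_smul {E : n → Matrix n n ℂ}
    (hE : IsSpectralResolution E) (f g : n → ℂ) :
    (∑ k, f k • E k) * (∑ k, g k • E k) = ∑ k, (f k * g k) • E k := by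
  simp [Finset.sum_mul, Finset.mul_sum, hE.mul_eq, smul_smul, mul_comm]

/-- The double-sum form of the derivative of the one-sided polar fidelity. -/
lemma exists_lyapunov_trace_eq_sum {E : n → Matrix n n ℂ} (hE : IsSpectralResolution E)
    {A X : Matrix n n ℂ} (hA : A.PosDef) (h w : n → ℝ)
    (hX : A * X + X * A = ∑ k, (w k : ℂ) • E k) :
    ∃ m : n → n → ℝ, (∀ k l, 0 ≤ m k l) ∧
      (((∑ k, (h k : ℂ) • E k) * (A * A) + A * A * ∑ k, (h k : ℂ) • E k) * X).trace.re -
        (((∑ k, (h k : ℂ) • E k) * ∑ k, (w k : ℂ) • E k) * A).trace.re =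
      ∑ k, ∑ l, m k l * ((h k - h l) * (w k - w l)) := by
  choose Y hY using fun k => hA.exists_lyapunov (E k)
  have hXY : X = ∑ l, (w l : ℂ) • Y l := by
    refine hA.lyapunov_injective ?_
    rw [hX, Finset.mul_sum, Finset.sum_mul, ← Finset.sum_add_distrib]
    exact Finset.sum_congr rfl fun l _ => by rw [← hY l]; simp
  have hdet : IsUnit A.det := (isUnit_iff_isUnit_det A).1 hA.isUnit
  have hsum : ∑ l, Y l = (1 / 2 : ℂ) • A⁻¹ := by
    refine hA.lyapunov_injective ?_
    rw [Finset.mul_sum, Finset.sum_mul, ← Finset.sum_add_distrib,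
      Finset.sum_congr rfl fun l _ => hY l, hE.sum_eq, Matrix.mul_smul, Matrix.smul_mul,
      mul_nonsing_inv A hdet, nonsing_inv_mul A hdet, ← add_smul]
    norm_num
  set m : n → n → ℝ := fun k l => (E k * (A * Y l * A)).trace.re with hm
  -- Substituting `E_k = A Y_k + Y_k A` splits `m k l` into two traces that cyclicity interchanges
  -- when `k` and `l` are swapped.
  have hsymm : ∀ k l, m k l = m l k := by
    intro k l
    have e : ∀ k l, (E k * (A * Y l * A)).trace =
        (Y k * A * Y l * (A * A)).trace + (Y k * (A * A) * Y l * A).trace := by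
      intro k l
      rw [← hY k, Matrix.add_mul, trace_add]
      congr 1
      · rw [Matrix.mul_assoc A, trace_mul_comm A]
        simp only [Matrix.mul_assoc]
      · simp only [Matrix.mul_assoc]
    have f : ∀ k l, (Y k * A * Y l * (A * A)).trace = (Y l * (A * A) * Y k * A).trace := by
      intro k l
      rw [Matrix.mul_assoc (Y k * A), trace_mul_comm]
      simp only [Matrix.mul_assoc]
    simp only [hm]
    rw [e, e, f k l, f l k, add_comm]
  -- The `Y_l` sum to `A⁻¹/2`, so row sums of `m` recover the diagonal term `Tr[H W A]`.
  have hrow : ∀ k, (E k * A).trace.re = 2 * ∑ l, m k l := by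
    intro k
    have : ∑ l, (E k * (A * Y l * A)).trace = (1 / 2 : ℂ) * (E k * A).trace := by
      rw [← trace_sum, ← Finset.mul_sum, ← Finset.sum_mul, ← Finset.mul_sum, hsum,
        Matrix.mul_smul, mul_nonsing_inv A hdet]
      simp
    have h2 := congrArg Complex.re this
    rw [Complex.re_sum] at h2
    simp only [hm]
    rw [h2, show (1 / 2 : ℂ) = ((1 / 2 : ℝ) : ℂ) by norm_num, Complex.re_ofReal_mul]
    ring
  refine ⟨m, fun k l => ?_, ?_⟩
  · have hYl := hA.lyapunov_posSemidef (hE.posSemidef l) (hY l)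
    have := hYl.conjTranspose_mul_mul_same A
    rw [hA.1.eq] at this
    exact (Complex.le_def.1 ((hE.posSemidef k).trace_mul_nonneg this)).1
  set H := ∑ k, (h k : ℂ) • E k with hH
  set W := ∑ k, (w k : ℂ) • E k with hW
  have hHW : H * W = ∑ k, ((h k * w k : ℝ) : ℂ) • E k := by
    rw [hH, hW, hE.sum_smul_mul_sum_smul]; push_cast; rfl
  have hWH : W * H = H * W := by
    rw [hH, hW, hE.sum_smul_mul_sum_smul, hE.sum_smul_mul_sum_smul]
    simp only [mul_comm]
  have e1 : ((H * (A * A) + A * A * H) * X).trace - (H * W * A).trace =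
      (H * W * A).trace - 2 * (H * (A * X * A)).trace := by
    have e2 : (H * (A * A) * X).trace + (H * (X * (A * A))).trace =
        (H * (A * W)).trace + (H * (W * A)).trace - 2 * (H * (A * X * A)).trace := by
      rw [← hX]
      simp only [Matrix.mul_add, Matrix.add_mul, trace_add, Matrix.mul_assoc]
      ring
    have e3 : (H * (A * W)).trace = (H * W * A).trace := by
      rw [← Matrix.mul_assoc, trace_mul_comm, ← Matrix.mul_assoc, hWH]
    have e4 : (A * A * H * X).trace = (H * (X * (A * A))).trace := by
      rw [Matrix.mul_assoc (A * A), trace_mul_comm, Matrix.mul_assoc]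
    rw [Matrix.add_mul, trace_add, e4, e2, e3, Matrix.mul_assoc H W A]
    ring
  rw [← Complex.sub_re, e1]
  have e5 : (H * W * A).trace.re = ∑ k, ∑ l, 2 * (h k * w k) * m k l := by
    rw [hHW, Finset.sum_mul, trace_sum, Complex.re_sum]
    refine Finset.sum_congr rfl fun k _ => ?_
    rw [Matrix.smul_mul, trace_smul, smul_eq_mul, Complex.re_ofReal_mul, hrow, ← Finset.mul_sum]
    ring
  have e6 : (H * (A * X * A)).trace.re = ∑ k, ∑ l, h k * w l * m k l := by
    have e : A * X * A = ∑ l, (w l : ℂ) • (A * Y l * A) := by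
      simp [hXY, Finset.mul_sum, Finset.sum_mul]
    rw [e, hH, Finset.sum_mul_sum, trace_sum, Complex.re_sum]
    refine Finset.sum_congr rfl fun k _ => ?_
    rw [trace_sum, Complex.re_sum]
    refine Finset.sum_congr rfl fun l _ => ?_
    rw [Matrix.smul_mul, Matrix.mul_smul, trace_smul, trace_smul,
      smul_eq_mul, smul_eq_mul, Complex.re_ofReal_mul, Complex.re_ofReal_mul]
    ring
  have e7 : ∑ k, ∑ l, h k * w k * m k l = ∑ k, ∑ l, h l * w l * m k l := by
    rw [Finset.sum_comm]
    exact Finset.sum_congr rfl fun l _ => Finset.sum_congr rfl fun k _ => by rw [hsymm]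
  have e8 : ∑ k, ∑ l, h k * w l * m k l = ∑ k, ∑ l, h l * w k * m k l := by
    rw [Finset.sum_comm]
    exact Finset.sum_congr rfl fun l _ => Finset.sum_congr rfl fun k _ => by rw [hsymm]
  have e9 : ∑ k, ∑ l, m k l * ((h k - h l) * (w k - w l)) =
      (∑ k, ∑ l, h k * w k * m k l) + (∑ k, ∑ l, h l * w l * m k l) -
        (∑ k, ∑ l, h k * w l * m k l) - ∑ k, ∑ l, h l * w k * m k l := by
    simp only [← Finset.sum_add_distrib, ← Finset.sum_sub_distrib]
    exact Finset.sum_congr rfl fun l _ => Finset.sum_congr rfl fun k _ => by ring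
  rw [e9, ← e7, ← e8, Complex.sub_re, e5, show (2 : ℂ) = ((2 : ℝ) : ℂ) by norm_num,
    Complex.re_ofReal_mul, e6]
  simp only [mul_assoc, ← Finset.mul_sum]
  ring

/-! ### Real powers of positive definite matrices. -/

lemma PosDef.rpow {P : Matrix n n ℂ} (hP : P.PosDef) (x : ℝ) : (CFC.rpow P x).PosDef :=
  isStrictlyPositive_iff_posDef.1 (hP.isStrictlyPositive.rpow P x)

lemma PosDef.rpow_mul_rpow {P : Matrix n n ℂ} (hP : P.PosDef) (x y : ℝ) :
    CFC.rpow P x * CFC.rpow P y = CFC.rpow P (x + y) :=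
  (CFC.rpow_add hP.isUnit).symm

lemma PosDef.rpow_rpow {P : Matrix n n ℂ} (hP : P.PosDef) (x y : ℝ) :
    CFC.rpow (CFC.rpow P x) y = CFC.rpow P (x * y) := by
  by_cases hx : x = 0
  · subst hx
    simp only [CFC.rpow_eq_pow, zero_mul]
    rw [CFC.rpow_zero P hP.posSemidef.nonneg, CFC.one_rpow]
  · exact CFC.rpow_rpow P x y hx hP.isStrictlyPositive

lemma PosSemidef.rpow_half_mul_self {A : Matrix n n ℂ} (hA : A.PosSemidef) :
    CFC.rpow A (1 / 2) * CFC.rpow A (1 / 2) = A := by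
  have := CFC.sqrt_mul_sqrt_self A hA.nonneg
  rwa [CFC.sqrt_eq_rpow] at this

lemma PosSemidef.rpow_half_eq {A B : Matrix n n ℂ} (hB : B.PosSemidef) (h : B * B = A) :
    CFC.rpow A (1 / 2) = B := by
  have := CFC.sqrt_unique h hB.nonneg
  rwa [CFC.sqrt_eq_rpow] at this

lemma PosDef.rpow_neg_eq_inv {P : Matrix n n ℂ} (hP : P.PosDef) (x : ℝ) :
    (CFC.rpow P x)⁻¹ = CFC.rpow P (-x) := by
  refine inv_eq_right_inv ?_
  rw [hP.rpow_mul_rpow, add_neg_cancel]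
  exact CFC.rpow_zero P hP.posSemidef.nonneg

/-- All real powers of a positive definite matrix are simultaneously diagonal. -/
lemma PosDef.exists_spectralResolution {P : Matrix n n ℂ} (hP : P.PosDef) :
    ∃ (E : n → Matrix n n ℂ) (p : n → ℝ), IsSpectralResolution E ∧ (∀ k, 0 < p k) ∧
      ∀ x : ℝ, CFC.rpow P x = ∑ k, ((p k ^ x : ℝ) : ℂ) • E k := by
  set U : Matrix n n ℂ := (hP.1.eigenvectorUnitary : Matrix n n ℂ) with hU
  have hUU : Uᴴ * U = 1 := by
    rw [← star_eq_conjTranspose]; exact Unitary.coe_star_mul_self _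
  have hUU' : U * Uᴴ = 1 := mul_eq_one_comm.1 hUU
  have hd : ∀ f : n → ℂ, ∑ k, f k • (U * diagonal (Pi.single k 1) * Uᴴ) = U * diagonal f * Uᴴ := by
    intro f
    have : diagonal f = ∑ k, f k • diagonal (Pi.single k (1 : ℂ)) := by
      ext i j
      simp [Matrix.sum_apply, diagonal_apply, Pi.single_apply]
    rw [this, Finset.mul_sum, Finset.sum_mul]
    simp
  refine ⟨fun k => U * diagonal (Pi.single k 1) * Uᴴ, hP.1.eigenvalues, ⟨fun k => ?_, fun k l => ?_, ?_⟩,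
    hP.eigenvalues_pos, fun x => ?_⟩
  · refine PosSemidef.mul_mul_conjTranspose_same (posSemidef_diagonal_iff.2 fun i => ?_) U
    by_cases h : i = k <;> simp [h]
  · have : U * diagonal (Pi.single k 1) * Uᴴ * (U * diagonal (Pi.single l 1) * Uᴴ) =
        U * (diagonal (Pi.single k 1) * diagonal (Pi.single l 1)) * Uᴴ := by
      simp only [Matrix.mul_assoc]
      rw [← Matrix.mul_assoc Uᴴ U, hUU, Matrix.one_mul]
    rw [this, diagonal_mul_diagonal]
    by_cases h : k = l
    · subst h
      have h1 : (fun i => (Pi.single k 1 : n → ℂ) i * (Pi.single k 1 : n → ℂ) i) =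
          Pi.single k 1 := by
        ext i; by_cases hi : i = k <;> simp [hi]
      simp [h1]
    · have h0 : (fun i => (Pi.single k 1 : n → ℂ) i * (Pi.single l 1 : n → ℂ) i) = 0 := by
        ext i; by_cases hi : i = k
        · subst hi; simp [h]
        · simp [hi]
      simp [h0, h]
  · have := hd 1
    simpa [hUU'] using this
  · rw [hd, CFC.rpow_eq_pow, CFC.rpow_eq_cfc_real hP.posSemidef.nonneg, hP.1.cfc_eq]
    rfl

/-! ### Differentiating along square-root and power curves. -/

/-- Differentiability of `Tr[A W]` for the square root `A` of a differentiable matrix curve,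
with the derivative expressed through a solution of the Lyapunov equation. -/
lemma hasDerivAt_trace_mul_of_sq {A Z W : ℝ → Matrix n n ℂ} {Z' W' X : Matrix n n ℂ} {t : ℝ}
    (hA : ∀ s, (A s).PosDef) (hZ : ∀ s, A s * A s = Z s) (hZ' : HasDerivAt Z Z' t)
    (hW' : HasDerivAt W W' t) (hX : A t * X + X * A t = W t) :
    HasDerivAt (fun s => (W s * A s).trace) ((Z' * X).trace + (W' * A t).trace) t := by
  obtain ⟨c, hc, hcA⟩ := (hA t).exists_pos_sub_posSemidef
  -- With `B = A s` and `Δ = A s - A t`, one has `B Δ + Δ (A t) = Z s - Z t`; coercivity makes the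
  -- square root Lipschitz at `t`.
  have hbound : ∀ s, c * ‖A s - A t‖ ≤ ‖Z s - Z t‖ := by
    intro s
    refine (mul_norm_le_norm_sylvester hc hcA (hA s).posSemidef _).trans_eq ?_
    congr 1
    rw [← hZ s, ← hZ t]
    noncomm_ring
  have hbig : (fun s => A s - A t) =O[nhds t] fun s => s - t := by
    refine (Asymptotics.IsBigO.of_bound c⁻¹ (Filter.Eventually.of_forall fun s => ?_)).trans
      hZ'.isBigO_sub
    rw [inv_mul_eq_div, le_div_iff₀ hc, mul_comm]
    exact hbound s
  have hpow : (fun s : ℝ => (s - t) ^ 2) =o[nhds t] fun s => s - t := by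
    simpa only [← norm_pow, Asymptotics.isLittleO_norm_left] using
      Asymptotics.isLittleO_pow_sub_sub t one_lt_two
  let T : Matrix n n ℂ →L[ℝ] ℂ := LinearMap.toContinuousLinearMap (traceLinearMap n ℝ ℂ)
  have hsq : (fun s => (((A s - A t) * (A s - A t)) * X).trace) =o[nhds t] fun s => s - t := by
    have h1 : (fun s => (A s - A t) * (A s - A t) * X) =O[nhds t] fun s => (s - t) * (s - t) * 1 :=
      (hbig.mul hbig).mul (Asymptotics.isBigO_const_const X one_ne_zero _)
    have h2 : (fun s : ℝ => (s - t) * (s - t) * 1) =o[nhds t] fun s => s - t := by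
      simp only [mul_one, ← pow_two]
      exact hpow
    exact (T.isBigO_comp _ _).trans_isLittleO (h1.trans_isLittleO h2)
  have h3 : HasDerivAt (fun s => (Z s * X).trace) ((Z' * X).trace) t :=
    T.hasFDerivAt.comp_hasDerivAt t (hZ'.mul_const X)
  have h4 : HasDerivAt (fun s => ((W s - W t) * A s).trace) ((W' * A t).trace) t := by
    refine T.hasFDerivAt.comp_hasDerivAt t (?_ : HasDerivAt (fun s => (W s - W t) * A s) _ t)
    refine hasDerivAt_iff_isLittleO.2 ?_
    have h5 : (fun s => W s - W t - (s - t) • W') =o[nhds t] fun s => s - t :=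
      hasDerivAt_iff_isLittleO.1 hW'
    have h6 : (fun s => (W s - W t) * (A s - A t)) =o[nhds t] fun s => s - t := by
      refine ((hW'.isBigO_sub).mul hbig).trans_isLittleO ?_
      simp only [← pow_two]
      exact hpow
    have h7 : (fun s => (W s - W t - (s - t) • W') * A t) =o[nhds t] fun s => (s - t) * 1 :=
      h5.mul_isBigO (Asymptotics.isBigO_const_const (A t) one_ne_zero _)
    simp only [mul_one] at h7
    refine (h6.add h7).congr_left fun s => ?_
    simp only [sub_self, Matrix.zero_mul, sub_zero, Matrix.sub_mul, Matrix.mul_sub, Matrix.smul_mul]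
    abel
  have h8 : HasDerivAt (fun s => (((A s - A t) * (A s - A t)) * X).trace) 0 t := by
    rw [hasDerivAt_iff_isLittleO]
    simpa using hsq
  have h9 := (((h3.sub_const ((Z t * X).trace)).sub h8).add h4).add_const ((W t * A t).trace)
  rw [sub_zero] at h9
  refine h9.congr_of_eventuallyEq (Filter.Eventually.of_forall fun s => ?_)
  -- An exact expansion: `Z s - Z t = Δ (A t) + (A t) Δ + Δ²` is paired with `X`. The `Δ²` term is
  -- `o(s - t)`, so `A` itself never has to be differentiated.
  have e : ((A s - A t) * W t).trace = (Z s * X).trace - (Z t * X).trace -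
      (((A s - A t) * (A s - A t)) * X).trace := by
    have e1 : ((A s - A t) * (A t * X + X * A t)).trace =
        (((A s - A t) * A t + A t * (A s - A t)) * X).trace := by
      rw [Matrix.mul_add, trace_add, Matrix.add_mul, trace_add, ← Matrix.mul_assoc,
        ← Matrix.mul_assoc, trace_mul_comm _ (A t), Matrix.mul_assoc (A t)]
    rw [← hX, e1, ← hZ s, ← hZ t, ← trace_sub, ← trace_sub]
    congr 1
    noncomm_ring
  rw [trace_mul_comm] at e
  simp only [Pi.add_apply, Pi.sub_apply]
  rw [← e, Matrix.sub_mul, trace_sub, Matrix.mul_sub, trace_sub]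
  ring

lemma PosDef.rpow_one {P : Matrix n n ℂ} (hP : P.PosDef) : CFC.rpow P 1 = P :=
  CFC.rpow_one P hP.posSemidef.nonneg

lemma PosDef.rpow_zero {P : Matrix n n ℂ} (hP : P.PosDef) : CFC.rpow P 0 = 1 :=
  CFC.rpow_zero P hP.posSemidef.nonneg

lemma PosDef.mul_mul_self {P Q : Matrix n n ℂ} (hP : P.PosDef) (hQ : Q.PosDef) :
    (P * Q * P).PosDef := by
  have h := hQ.conjTranspose_mul_mul_same (B := P) fun v w hvw => by
    have := congrArg (P⁻¹ *ᵥ ·) hvw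
    simpa [nonsing_inv_mul P ((isUnit_iff_isUnit_det P).1 hP.isUnit)] using this
  rwa [hP.1.eq] at h

lemma PosSemidef.im_trace_mul {A B : Matrix n n ℂ} (hA : A.PosSemidef) (hB : B.PosSemidef) :
    (A * B).trace.im = 0 :=
  (Complex.le_def.1 (hA.trace_mul_nonneg hB)).2.symm

/-- Applied to the exponents `s / 2` and `(1 - s) / 2`, this yields the generators `H` and `-H` with
the same `H = ½ log P`. -/
lemma hasDerivAt_rpow_comp {P : Matrix n n ℂ} {E : n → Matrix n n ℂ} {p : n → ℝ}
    (hE : IsSpectralResolution E) (hp : ∀ k, 0 < p k)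
    (hPE : ∀ x : ℝ, CFC.rpow P x = ∑ k, ((p k ^ x : ℝ) : ℂ) • E k)
    {g : ℝ → ℝ} {c t : ℝ} (hg : HasDerivAt g c t) :
    HasDerivAt (fun s => CFC.rpow P (g s))
      ((∑ k, ((c * Real.log (p k) : ℝ) : ℂ) • E k) * CFC.rpow P (g t)) t := by
  simp only [hPE]
  rw [hE.sum_smul_mul_sum_smul]
  refine HasDerivAt.fun_sum fun k _ => ?_
  have h1 : HasDerivAt (fun s => p k ^ g s) (c * Real.log (p k) * p k ^ g t) t := by
    convert hg.const_rpow (hp k) using 1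
    ring
  have h2 := h1.ofReal_comp
  push_cast at h2 ⊢
  exact h2.smul_const (E k)

end Matrix

/-! ### Monotonicity of the one-sided polar fidelities. -/

section PolarFidelity

open Matrix
open scoped Matrix.Norms.Frobenius

variable {d : ℕ} {P Q : Matrix (Fin d) (Fin d) ℂ}

/-- The first root is `P^{(1+x)/2}`, and the factor `P^{-x}` lowers it to `P^{(1-x)/2}`. -/
lemma polarLeft_eq (hP : P.PosDef) (x : ℝ) :
    polarLeft P Q x = (CFC.rpow P ((1 - x) / 2) *
      CFC.rpow (CFC.rpow P (x / 2) * Q * CFC.rpow P (x / 2)) (1 / 2)).trace := by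
  have h1 : CFC.rpow (CFC.rpow P x) (1 / 2) = CFC.rpow P (x / 2) := by
    rw [hP.rpow_rpow]; congr 1; ring
  have h2 : CFC.rpow (CFC.rpow P (x / 2) * P * CFC.rpow P (x / 2)) (1 / 2) =
      CFC.rpow P ((1 + x) / 2) := by
    refine (hP.rpow _).posSemidef.rpow_half_eq ?_
    conv_rhs => enter [1, 2]; rw [← hP.rpow_one]
    simp only [hP.rpow_mul_rpow]
    congr 1; ring
  rw [polarLeft, genFidelity, h1, h2, hP.rpow_neg_eq_inv, hP.rpow_mul_rpow]
  congr 3; ring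

lemma polarRight_eq (hQ : Q.PosDef) (x : ℝ) : polarRight P Q x = polarLeft Q P x := by
  have h1 : CFC.rpow (CFC.rpow Q x) (1 / 2) = CFC.rpow Q (x / 2) := by
    rw [hQ.rpow_rpow]; congr 1; ring
  have h2 : CFC.rpow (CFC.rpow Q (x / 2) * Q * CFC.rpow Q (x / 2)) (1 / 2) =
      CFC.rpow Q ((1 + x) / 2) := by
    refine (hQ.rpow _).posSemidef.rpow_half_eq ?_
    conv_rhs => enter [1, 2]; rw [← hQ.rpow_one]
    simp only [hQ.rpow_mul_rpow]
    congr 1; ring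
  rw [polarLeft_eq hQ, polarRight, genFidelity, h1, h2, hQ.rpow_neg_eq_inv, Matrix.mul_assoc,
    hQ.rpow_mul_rpow, trace_mul_comm]
  congr 3; ring

lemma polarLeft_im (hP : P.PosDef) (hQ : Q.PosDef) (x : ℝ) : (polarLeft P Q x).im = 0 := by
  rw [polarLeft_eq hP]
  exact (hP.rpow _).posSemidef.im_trace_mul
    (((hP.rpow _).mul_mul_self hQ).rpow _).posSemidef

lemma exists_hasDerivAt_re_polarLeft (hP : P.PosDef) (hQ : Q.PosDef) (t : ℝ) :
    ∃ D, HasDerivAt (fun x => (polarLeft P Q x).re) D t ∧ (t ≤ 1 → 0 ≤ D) ∧ (1 ≤ t → D ≤ 0) := by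
  obtain ⟨E, p, hE, hp, hPE⟩ := hP.exists_spectralResolution
  set h : Fin d → ℝ := fun k => 1 / 2 * Real.log (p k) with hh
  set H : Matrix (Fin d) (Fin d) ℂ := ∑ k, (h k : ℂ) • E k with hH
  set w : Fin d → ℝ := fun k => p k ^ ((1 - t) / 2) with hw
  let A : ℝ → Matrix (Fin d) (Fin d) ℂ := fun s =>
    CFC.rpow (CFC.rpow P (s / 2) * Q * CFC.rpow P (s / 2)) (1 / 2)
  have hA : ∀ s, (A s).PosDef := fun s => ((hP.rpow _).mul_mul_self hQ).rpow _
  have hZ : ∀ s, A s * A s = CFC.rpow P (s / 2) * Q * CFC.rpow P (s / 2) := fun s =>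
    ((hP.rpow _).mul_mul_self hQ).posSemidef.rpow_half_mul_self
  have hR : HasDerivAt (fun s : ℝ => CFC.rpow P (s / 2)) (H * CFC.rpow P (t / 2)) t :=
    hasDerivAt_rpow_comp hE hp hPE ((hasDerivAt_id t).div_const 2)
  have hW : HasDerivAt (fun s : ℝ => CFC.rpow P ((1 - s) / 2))
      (-(H * CFC.rpow P ((1 - t) / 2))) t := by
    refine (hasDerivAt_rpow_comp hE hp hPE
      (((hasDerivAt_id' t).const_sub 1).div_const 2)).congr_deriv ?_
    rw [← Matrix.neg_mul, hH, ← Finset.sum_neg_distrib]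
    congr 1
    refine Finset.sum_congr rfl fun k _ => ?_
    rw [← neg_smul]
    congr 1
    simp only [hh]
    push_cast
    ring
  have hcomm : CFC.rpow P (t / 2) * H = H * CFC.rpow P (t / 2) := by
    rw [hPE, hH, hE.sum_smul_mul_sum_smul, hE.sum_smul_mul_sum_smul]
    simp only [mul_comm]
  have hZ' : HasDerivAt (fun s : ℝ => CFC.rpow P (s / 2) * Q * CFC.rpow P (s / 2))
      (H * (A t * A t) + A t * A t * H) t := by
    refine ((hR.mul_const Q).mul hR).congr_deriv ?_
    rw [hZ, ← hcomm]
    simp only [Matrix.mul_assoc, hcomm]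
  obtain ⟨X, hX⟩ := (hA t).exists_lyapunov (CFC.rpow P ((1 - t) / 2))
  have hD := hasDerivAt_trace_mul_of_sq hA hZ hZ' hW hX
  obtain ⟨m, hm, hsum⟩ := exists_lyapunov_trace_eq_sum hE (hA t) h w (hX.trans (hPE _))
  have hD' := Complex.reCLM.hasFDerivAt.comp_hasDerivAt t hD
  refine ⟨_, hD'.congr_of_eventuallyEq (Filter.Eventually.of_forall fun s => ?_), ?_⟩
  · simp only [Function.comp, Complex.reCLM_apply, A]
    rw [polarLeft_eq hP]
  have hval : Complex.reCLM (((H * (A t * A t) + A t * A t * H) * X).trace +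
      (-(H * CFC.rpow P ((1 - t) / 2)) * A t).trace) =
      ∑ k, ∑ l, m k l * ((h k - h l) * (w k - w l)) := by
    rw [← hsum, Complex.reCLM_apply, Matrix.neg_mul, trace_neg, Complex.add_re, Complex.neg_re,
      ← hPE, ← sub_eq_add_neg]
  rw [hval]
  -- `h` always follows the order of the eigenvalues; the sign of `1 - t` decides whether `w`
  -- follows or reverses it.
  have hmono : ∀ k l, p k ≤ p l → h k ≤ h l := fun k l hkl =>
    mul_le_mul_of_nonneg_left (Real.log_le_log (hp k) hkl) (by norm_num)
  refine ⟨fun ht => ?_, fun ht => ?_⟩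
  · have hwm : ∀ k l, p k ≤ p l → w k ≤ w l := fun k l hkl =>
      Real.rpow_le_rpow (hp k).le hkl (by linarith)
    refine Finset.sum_nonneg fun k _ => Finset.sum_nonneg fun l _ => mul_nonneg (hm k l) ?_
    rcases le_total (p k) (p l) with hkl | hkl
    · exact mul_nonneg_of_nonpos_of_nonpos (sub_nonpos.2 (hmono _ _ hkl))
        (sub_nonpos.2 (hwm _ _ hkl))
    · exact mul_nonneg (sub_nonneg.2 (hmono _ _ hkl)) (sub_nonneg.2 (hwm _ _ hkl))
  · have hwm : ∀ k l, p k ≤ p l → w l ≤ w k := fun k l hkl =>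
      Real.rpow_le_rpow_of_nonpos (hp k) hkl (by linarith)
    refine Finset.sum_nonpos fun k _ => Finset.sum_nonpos fun l _ =>
      mul_nonpos_of_nonneg_of_nonpos (hm k l) ?_
    rcases le_total (p k) (p l) with hkl | hkl
    · exact mul_nonpos_of_nonpos_of_nonneg (sub_nonpos.2 (hmono _ _ hkl))
        (sub_nonneg.2 (hwm _ _ hkl))
    · exact mul_nonpos_of_nonneg_of_nonpos (sub_nonneg.2 (hmono _ _ hkl))
        (sub_nonpos.2 (hwm _ _ hkl))

lemma monotoneOn_re_polarLeft (hP : P.PosDef) (hQ : Q.PosDef) :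
    MonotoneOn (fun x => (polarLeft P Q x).re) (Set.Iic 1) := by
  choose D hD hD0 _ using exists_hasDerivAt_re_polarLeft hP hQ
  refine monotoneOn_of_deriv_nonneg (convex_Iic 1)
    (fun x _ => (hD x).continuousAt.continuousWithinAt)
    (fun x _ => (hD x).differentiableAt.differentiableWithinAt) fun x hx => ?_
  rw [(hD x).deriv]
  exact hD0 x (Set.mem_Iic.1 (interior_subset hx))

lemma antitoneOn_re_polarLeft (hP : P.PosDef) (hQ : Q.PosDef) :
    AntitoneOn (fun x => (polarLeft P Q x).re) (Set.Ici 1) := by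
  choose D hD _ hD0 using exists_hasDerivAt_re_polarLeft hP hQ
  refine antitoneOn_of_deriv_nonpos (convex_Ici 1)
    (fun x _ => (hD x).continuousAt.continuousWithinAt)
    (fun x _ => (hD x).differentiableAt.differentiableWithinAt) fun x hx => ?_
  rw [(hD x).deriv]
  exact hD0 x (interior_subset hx)

/-! ### Special values and their symmetry. -/

lemma polarLeft_one (hP : P.PosDef) : polarLeft P Q 1 = uhlmannFidelity P Q := by
  rw [polarLeft_eq hP, uhlmannFidelity, sub_self, zero_div, hP.rpow_zero, Matrix.one_mul]

lemma polarLeft_zero (hP : P.PosDef) :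
    polarLeft P Q 0 = holevoFidelity P Q := by
  rw [polarLeft_eq hP, holevoFidelity, sub_zero, zero_div, hP.rpow_zero, Matrix.one_mul,
    Matrix.mul_one]

lemma polarLeft_neg_one (hP : P.PosDef) :
    polarLeft P Q (-1) = matsumotoFidelity P Q := by
  rw [polarLeft_eq hP, matsumotoFidelity, trace_mul_comm _ (CFC.rpow P (1 / 2)),
    ← Matrix.mul_assoc, hP.rpow_mul_rpow]
  norm_num

lemma uhlmannFidelity_comm (hP : P.PosDef) (hQ : Q.PosDef) :
    uhlmannFidelity P Q = uhlmannFidelity Q P := by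
  rw [uhlmannFidelity, uhlmannFidelity]
  have hZ := (hP.rpow (1 / 2)).mul_mul_self hQ
  have hA := hZ.rpow (1 / 2)
  have hAA := hZ.posSemidef.rpow_half_mul_self
  have hPP := hP.posSemidef.rpow_half_mul_self
  have hQQ := hQ.posSemidef.rpow_half_mul_self
  have hp := (hP.rpow (1 / 2)).1.eq
  have hq := (hQ.rpow (1 / 2)).1.eq
  set A := CFC.rpow (CFC.rpow P (1 / 2) * Q * CFC.rpow P (1 / 2)) (1 / 2)
  set p := CFC.rpow P (1 / 2)
  set q := CFC.rpow Q (1 / 2)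
  have hdet : IsUnit A.det := (isUnit_iff_isUnit_det A).1 hA.isUnit
  have h1 : p * q * (q * p) = A * A := by
    rw [hAA, ← hQQ]; simp only [Matrix.mul_assoc]
  have h2 : q * p * (p * q) = q * P * q := by
    rw [← hPP]; simp only [Matrix.mul_assoc]
  -- Polar decomposition: `V = A⁻¹ p q` is unitary and `Vᴴ A V = q p A⁻¹ p q` is the root of `q P
  -- q`, hence has the same trace as `A`.
  have hB : CFC.rpow (q * P * q) (1 / 2) = q * p * A⁻¹ * (p * q) := by
    refine PosSemidef.rpow_half_eq ?_ ?_
    · have := hA.inv.posSemidef.mul_mul_conjTranspose_same (q * p)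
      rwa [conjTranspose_mul, hp, hq] at this
    · rw [← h2]
      calc q * p * A⁻¹ * (p * q) * (q * p * A⁻¹ * (p * q))
          = q * p * (A⁻¹ * (p * q * (q * p)) * A⁻¹) * (p * q) := by
            simp only [Matrix.mul_assoc]
        _ = q * p * (p * q) := by
            rw [h1, nonsing_inv_mul_cancel_left _ _ hdet, mul_nonsing_inv A hdet, Matrix.mul_one]
  rw [hB, trace_mul_comm, ← Matrix.mul_assoc, h1, mul_nonsing_inv_cancel_right _ _ hdet]

lemma matsumotoFidelity_comm (hP : P.PosDef) (hQ : Q.PosDef) :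
    matsumotoFidelity P Q = matsumotoFidelity Q P := by
  rw [matsumotoFidelity, matsumotoFidelity]
  have hZ := (hP.rpow (-1 / 2)).mul_mul_self hQ
  have hT := hZ.rpow (1 / 2)
  have hTT := hZ.posSemidef.rpow_half_mul_self
  have hG := (hP.rpow (1 / 2)).mul_mul_self hT
  have inv : ∀ {R : Matrix (Fin d) (Fin d) ℂ}, R.PosDef →
      CFC.rpow R (1 / 2) * CFC.rpow R (-1 / 2) = 1 ∧ CFC.rpow R (-1 / 2) * CFC.rpow R (1 / 2) = 1 ∧
      CFC.rpow R (-1 / 2) * CFC.rpow R (-1 / 2) = R⁻¹ := by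
    intro R hR
    rw [hR.rpow_mul_rpow, hR.rpow_mul_rpow, hR.rpow_mul_rpow, ← hR.rpow_zero]
    refine ⟨by norm_num, by norm_num, ?_⟩
    have := hR.rpow_neg_eq_inv 1
    rw [hR.rpow_one] at this
    rw [this]; norm_num
  obtain ⟨p1, p2, p3⟩ := inv hP
  obtain ⟨q1, q2, q3⟩ := inv hQ
  have hdP : IsUnit P.det := (isUnit_iff_isUnit_det P).1 hP.isUnit
  have hq := hQ.rpow (-1 / 2)
  set T := CFC.rpow (CFC.rpow P (-1 / 2) * Q * CFC.rpow P (-1 / 2)) (1 / 2)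
  set G := CFC.rpow P (1 / 2) * T * CFC.rpow P (1 / 2) with hGdef
  have hdG : IsUnit G.det := (isUnit_iff_isUnit_det G).1 hG.isUnit
  set p := CFC.rpow P (1 / 2)
  set p' := CFC.rpow P (-1 / 2)
  set q := CFC.rpow Q (1 / 2)
  set q' := CFC.rpow Q (-1 / 2)
  -- The geometric mean `G` solves this Riccati equation; inverting it exchanges `P` and `Q`, and
  -- uniqueness of positive square roots shows that `G` is also the mean of `Q` and `P`.
  have h1 : G * P⁻¹ * G = Q := by
    calc G * P⁻¹ * G = p * T * (p * p') * (p' * p) * T * p := by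
          rw [hGdef, ← p3]; simp only [Matrix.mul_assoc]
      _ = p * (T * T) * p := by rw [p1, p2]; simp only [Matrix.mul_assoc, Matrix.mul_one]
      _ = (p * p') * Q * (p' * p) := by rw [hTT]; simp only [Matrix.mul_assoc]
      _ = Q := by rw [p1, p2, Matrix.one_mul, Matrix.mul_one]
  clear_value G
  have h2 : G * Q⁻¹ * G = P := by
    rw [← h1, Matrix.mul_inv_rev _ G, Matrix.mul_inv_rev G, nonsing_inv_nonsing_inv P hdP,
      ← Matrix.mul_assoc, ← Matrix.mul_assoc, mul_nonsing_inv G hdG, Matrix.one_mul,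
      nonsing_inv_mul_cancel_right _ _ hdG]
  have h3 : CFC.rpow (q' * P * q') (1 / 2) = q' * G * q' := by
    refine (hq.mul_mul_self hG).posSemidef.rpow_half_eq ?_
    rw [← h2, ← q3]
    simp only [Matrix.mul_assoc]
  rw [h3]
  congr 1
  calc G = (q * q') * G * (q' * q) := by rw [q1, q2, Matrix.one_mul, Matrix.mul_one]
    _ = q * (q' * G * q') * q := by simp only [Matrix.mul_assoc]

lemma holevoFidelity_comm : holevoFidelity P Q = holevoFidelity Q P :=
  trace_mul_comm _ _

/-! ### The commuting case and the main theorem. -/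

lemma polarLeft_of_commute (hP : P.PosDef) (hQ : Q.PosDef) (h : Commute P Q) (x : ℝ) :
    polarLeft P Q x = holevoFidelity P Q := by
  have hc : ∀ y z : ℝ, Commute (CFC.rpow P y) (CFC.rpow Q z) := fun y z =>
    ((h.cfc_nnreal _).symm.cfc_nnreal _).symm
  have hQQ := hQ.posSemidef.rpow_half_mul_self
  have hB : CFC.rpow (CFC.rpow P (x / 2) * Q * CFC.rpow P (x / 2)) (1 / 2) =
      CFC.rpow P (x / 2) * CFC.rpow Q (1 / 2) := by
    refine PosSemidef.rpow_half_eq ?_ ?_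
    · have h1 := ((hP.rpow (x / 4)).mul_mul_self (hQ.rpow (1 / 2))).posSemidef
      rw [Matrix.mul_assoc, ← (hc _ _).eq, ← Matrix.mul_assoc, hP.rpow_mul_rpow] at h1
      convert h1 using 3
      ring
    · conv_rhs => rw [← hQQ]
      calc CFC.rpow P (x / 2) * CFC.rpow Q (1 / 2) * (CFC.rpow P (x / 2) * CFC.rpow Q (1 / 2))
          = CFC.rpow P (x / 2) * CFC.rpow Q (1 / 2) * (CFC.rpow Q (1 / 2) * CFC.rpow P (x / 2)) := by
            rw [(hc _ _).eq]
        _ = _ := by simp only [Matrix.mul_assoc]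
  rw [polarLeft_eq hP, hB, ← Matrix.mul_assoc, hP.rpow_mul_rpow, holevoFidelity]
  congr 3; ring

end PolarFidelity

theorem mainTheorem9 (d : ℕ) (P Q : Matrix (Fin d) (Fin d) ℂ) (hP : P.PosDef) (hQ : Q.PosDef) :
    -- all the fidelities involved are real numbers
    (∀ x : ℝ, (polarLeft P Q x).im = 0 ∧ (polarRight P Q x).im = 0 ∧
      (polarFidelity P Q x).im = 0) ∧
    (uhlmannFidelity P Q).im = 0 ∧ (holevoFidelity P Q).im = 0 ∧ (matsumotoFidelity P Q).im = 0 ∧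
    -- monotonicity on the two ranges, global maximum at `1`, upper bound
    MonotoneOn (fun x : ℝ => (polarFidelity P Q x).re) (Set.Iic 1) ∧
    AntitoneOn (fun x : ℝ => (polarFidelity P Q x).re) (Set.Ici 1) ∧
    IsMaxOn (fun x : ℝ => (polarFidelity P Q x).re) Set.univ 1 ∧
    polarLeft P Q 1 = uhlmannFidelity P Q ∧
    polarRight P Q 1 = uhlmannFidelity P Q ∧
    polarFidelity P Q 1 = uhlmannFidelity P Q ∧
    (∀ x : ℝ, (polarFidelity P Q x).re ≤ (uhlmannFidelity P Q).re) ∧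
    -- monotone interpolation on `[-1, 1]`
    MonotoneOn (fun x : ℝ => (polarFidelity P Q x).re) (Set.Icc (-1) 1) ∧
    polarFidelity P Q (-1) = matsumotoFidelity P Q ∧
    polarFidelity P Q 0 = holevoFidelity P Q ∧
    (∀ x ∈ Set.Icc (-1 : ℝ) 1, (matsumotoFidelity P Q).re ≤ (polarFidelity P Q x).re) ∧
    -- commuting matrices: all values coincide, so every point is a maximizer
    (P * Q = Q * P →
      (∀ x : ℝ,
        polarLeft P Q x = (CFC.rpow P (1 / 2) * CFC.rpow Q (1 / 2)).trace ∧
        polarRight P Q x = (CFC.rpow P (1 / 2) * CFC.rpow Q (1 / 2)).trace ∧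
        polarFidelity P Q x = (CFC.rpow P (1 / 2) * CFC.rpow Q (1 / 2)).trace) ∧
      ∀ x : ℝ, IsMaxOn (fun y : ℝ => (polarFidelity P Q y).re) Set.univ x) := by
  have hone : polarFidelity P Q 1 = uhlmannFidelity P Q := by
    rw [polarFidelity, polarRight_eq hQ, polarLeft_one hP, polarLeft_one hQ,
      ← uhlmannFidelity_comm hP hQ]
    ring
  have hneg : polarFidelity P Q (-1) = matsumotoFidelity P Q := by
    rw [polarFidelity, polarRight_eq hQ, polarLeft_neg_one hP, polarLeft_neg_one hQ,
      ← matsumotoFidelity_comm hP hQ]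
    ring
  have hre : ∀ x, (polarFidelity P Q x).re =
      ((polarLeft P Q x).re + (polarLeft Q P x).re) / 2 := by
    intro x
    rw [polarFidelity, polarRight_eq hQ, Complex.div_ofNat_re, Complex.add_re]
  have hmono : MonotoneOn (fun x : ℝ => (polarFidelity P Q x).re) (Set.Iic 1) := by
    intro x hx y hy hxy
    have h1 := monotoneOn_re_polarLeft hP hQ hx hy hxy
    have h2 := monotoneOn_re_polarLeft hQ hP hx hy hxy
    simp only [hre] at h1 h2 ⊢
    linarith
  have hanti : AntitoneOn (fun x : ℝ => (polarFidelity P Q x).re) (Set.Ici 1) := by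
    intro x hx y hy hxy
    have h1 := antitoneOn_re_polarLeft hP hQ hx hy hxy
    have h2 := antitoneOn_re_polarLeft hQ hP hx hy hxy
    simp only [hre] at h1 h2 ⊢
    linarith
  have hmax : ∀ x : ℝ, (polarFidelity P Q x).re ≤ (polarFidelity P Q 1).re := by
    intro x
    rcases le_total x 1 with hx | hx
    · exact hmono hx Set.self_mem_Iic hx
    · exact hanti Set.self_mem_Ici hx hx
  have hcomm : P * Q = Q * P → ∀ x : ℝ, polarLeft P Q x = holevoFidelity P Q ∧
      polarRight P Q x = holevoFidelity P Q ∧ polarFidelity P Q x = holevoFidelity P Q := by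
    intro h x
    have h1 := polarLeft_of_commute hP hQ h x
    have h2 : polarRight P Q x = holevoFidelity P Q := by
      rw [polarRight_eq hQ, polarLeft_of_commute hQ hP h.symm x, holevoFidelity_comm]
    refine ⟨h1, h2, ?_⟩
    rw [polarFidelity, h1, h2]
    ring
  refine ⟨fun x => ⟨polarLeft_im hP hQ x, ?_, ?_⟩, ?_, ?_, ?_, hmono, hanti, fun x _ => hmax x,
    polarLeft_one hP, ?_, hone, fun x => hone ▸ hmax x,
    hmono.mono Set.Icc_subset_Iic_self, hneg, ?_, fun x hx => ?_, fun h => ⟨hcomm h, ?_⟩⟩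
  · rw [polarRight_eq hQ]; exact polarLeft_im hQ hP x
  · rw [polarFidelity, polarRight_eq hQ, Complex.div_ofNat_im, Complex.add_im,
      polarLeft_im hP hQ, polarLeft_im hQ hP]
    norm_num
  · rw [← polarLeft_one hP]; exact polarLeft_im hP hQ _
  · rw [← polarLeft_zero hP]; exact polarLeft_im hP hQ _
  · rw [← polarLeft_neg_one hP]; exact polarLeft_im hP hQ _
  · rw [polarRight_eq hQ, polarLeft_one hQ, uhlmannFidelity_comm hQ hP]
  · rw [polarFidelity, polarRight_eq hQ, polarLeft_zero hP, polarLeft_zero hQ,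
      holevoFidelity_comm (P := Q)]
    ring
  · rw [← hneg]
    exact hmono (show (-1 : ℝ) ≤ 1 by norm_num) hx.2 hx.1
  · intro x y _
    simp only [Set.mem_ofPred_eq, (hcomm h _).2.2, le_refl]
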